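/- Let $k\ge 1$ and let $\Delta=(\mathbf p_0,\dots,\mathbf p_k)$ be a non-degenerate $k$-simplex in $\mathbb R^k$, i.e. $k+1$ affinely independent points. For $n\ge 1$ let $C_n(\mathbb R^k)$ be the space of $n$-tuples of distinct points of $\mathbb R^k$, and let $C_n[\mathbb R^k]$ be the closure of its image in $(\mathbb R^k)^n\times (S^{k-1})^{n(n-1)}\times[0,\infty]^{n(n-1)(n-2)}$ under the map $\mathbf q\mapsto(\mathbf q,(\pi_{ij}(\mathbf q)),(r_{ijl}(\mathbf q)))$, where $\pi_{ij}(\mathbf q)=\frac{\mathbf q_i-\mathbf q_j}{\|\mathbf q_i-\mathbf q_j\|}$ and $r_{ijl}(\mathbf q)=\frac{\|\mathbf q_i-\mathbf q_j\|}{\|\mathbf q_i-\mathbf q_l\|}$ for pairwise distinct indices; identify $C_n(\mathbb R^k)$ with its image and put $\partial C_n[\mathbb R^k]=C_n[\mathbb R^k]\setminus C_n(\mathbb R^k)$. For a set $S$ of at least two labels, the $S$-face of $\partial C_n[\mathbb R^k]$ is the closure of the set of those points of $\partial C_n[\mathbb R^k]$ for which exactly the points labelled by $S$ coincide and all ratios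 $r_{ijl}$ with $i,j,l\in S$ lie in $(0,\infty)$; its interior consists of the points of the $S$-face that lie on no other such face. Let $\mathrm{Sim}(\Delta)\subset C_{k+1}(\mathbb R^k)$ be the set of configurations $\mathbf q$ similar to $\Delta$, i.e. with $r_{ijl}(\mathbf q)=r_{ijl}(\Delta)$ for all pairwise distinct $i,j,l$, and let $\partial\,\mathrm{Sim}(\Delta)=\overline{\mathrm{Sim}(\Delta)}\setminus \mathrm{Sim}(\Delta)$, the closure being taken in $C_{k+1}[\mathbb R^k]$. Then $\partial\,\mathrm{Sim}(\Delta)$ is contained in the interior of the $(0,\dots,k)$-face of $\partial C_{k+1}[\mathbb R^k]$ (the face where all points collide), and $\partial\,\mathrm{Sim}(\Delta)$ is diffeomorphic to $\operatorname{O}(k)\times\{0\}\times\mathbb R^k$. Here smoothness is that of maps between subsets of Euclidean spaces (local extendability to $C^\infty$ maps on open sets), with $S^{k-1}\subset\mathbb R^k$ and $[0,\infty]\cong[0,1]$ via $r\mapsto r/(1+r)$. -/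

import Mathlib

open scoped ENNReal ContDiff Matrix.Norms.Elementwise

noncomputable section

/-! ### The compactified configuration space `C_n[ℝ^k]` -/

/-- Euclidean space `ℝ^k`. -/
abbrev EucSpace (k : ℕ) : Type := EuclideanSpace ℝ (Fin k)

/-- The unit sphere `S^{k-1}` in `ℝ^k`. -/
abbrev UnitSphere (k : ℕ) : Type := Metric.sphere (0 : EucSpace k) 1

/-- Ordered pairs of distinct indices. -/
abbrev DistinctPair (n : ℕ) : Type := {p : Fin n × Fin n // p.1 ≠ p.2}

/-- Ordered triples of pairwise distinct indices. -/
abbrev DistinctTriple (n : ℕ) : Type :=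
  {t : Fin n × Fin n × Fin n // t.1 ≠ t.2.1 ∧ t.2.1 ≠ t.2.2 ∧ t.1 ≠ t.2.2}

/-- The open configuration space `C_n(ℝ^k)` of `n` distinct labelled points. -/
abbrev OpenConfig (n k : ℕ) : Type := {q : Fin n → EucSpace k // Function.Injective q}

/-- `A_n[ℝ^k] = (ℝ^k)^n × (S^{k-1})^{n(n-1)} × [0,∞]^{n(n-1)(n-2)}`. -/
abbrev ConfigAmbient (n k : ℕ) : Type :=
  (Fin n → EucSpace k) × (DistinctPair n → UnitSphere k) × (DistinctTriple n → ℝ≥0∞)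

/-- `π_{ij}(q) = (q_i - q_j) / ‖q_i - q_j‖`. -/
def direction {n k : ℕ} (q : OpenConfig n k) (p : DistinctPair n) : UnitSphere k :=
  ⟨‖q.1 p.1.1 - q.1 p.1.2‖⁻¹ • (q.1 p.1.1 - q.1 p.1.2), by
    have h : ‖q.1 p.1.1 - q.1 p.1.2‖ ≠ 0 :=
      norm_ne_zero_iff.mpr (sub_ne_zero.mpr fun e => p.2 (q.2 e))
    rw [mem_sphere_zero_iff_norm, norm_smul, norm_inv, norm_norm, inv_mul_cancel₀ h]⟩

/-- `r_{ijl}(q) = ‖q_i - q_j‖ / ‖q_i - q_l‖`, as an element of `[0,∞]`. -/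
def distRatio {n k : ℕ} (q : OpenConfig n k) (t : DistinctTriple n) : ℝ≥0∞ :=
  ENNReal.ofReal (‖q.1 t.1.1 - q.1 t.1.2.1‖ / ‖q.1 t.1.1 - q.1 t.1.2.2‖)

/-- The map `α_n = ι × (π_{ij}) × (r_{ijl}) : C_n(ℝ^k) → A_n[ℝ^k]`. -/
def configEmbed {n k : ℕ} (q : OpenConfig n k) : ConfigAmbient n k :=
  (q.1, direction q, distRatio q)

/-- The compactified configuration space `C_n[ℝ^k]`: the closure of the image of `α_n`. -/
def compactConfig (n k : ℕ) : Set (ConfigAmbient n k) :=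
  closure (Set.range (configEmbed (n := n) (k := k)))

/-- `∂C_n[ℝ^k] = C_n[ℝ^k] \ C_n(ℝ^k)`. -/
def compactConfigBoundary (n k : ℕ) : Set (ConfigAmbient n k) :=
  compactConfig n k \ Set.range (configEmbed (n := n) (k := k))

/-! ### The faces of `∂C_n[ℝ^k]` -/

/-- The open stratum of `∂C_n[ℝ^k]` in which exactly the points labelled by `S` have collided, all
of them at comparable rates (no limiting ratio of distances inside `S` is `0` or `∞`). -/
def collisionStratum {n : ℕ} (k : ℕ) (S : Finset (Fin n)) : Set (ConfigAmbient n k) :=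
  {x | x ∈ compactConfigBoundary n k ∧
    (∀ i j : Fin n, x.1 i = x.1 j ↔ (i = j ∨ (i ∈ S ∧ j ∈ S))) ∧
    ∀ t : DistinctTriple n, t.1.1 ∈ S → t.1.2.1 ∈ S → t.1.2.2 ∈ S →
      x.2.2 t ≠ 0 ∧ x.2.2 t ≠ ⊤}

/-- The closed face of `∂C_n[ℝ^k]` in which the points labelled by `S` collide. For `2 ≤ #S` these
are the codimension-one faces of the manifold with corners `C_n[ℝ^k]`. -/
def collisionFace {n : ℕ} (k : ℕ) (S : Finset (Fin n)) : Set (ConfigAmbient n k) :=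
  closure (collisionStratum k S)

/-- The interior of the face of `S`: the points of that face which lie on no other
codimension-one face. -/
def collisionFaceInterior {n : ℕ} (k : ℕ) (S : Finset (Fin n)) : Set (ConfigAmbient n k) :=
  {x | x ∈ collisionFace k S ∧
    ∀ T : Finset (Fin n), 2 ≤ T.card → T ≠ S → x ∉ collisionFace k T}

/-! ### Simplices similar to a given one -/

/-- The vertices of a non-degenerate simplex as a point of `C_{k+1}(ℝ^k)`. -/
def simplexConfig {k : ℕ} (Δ : Affine.Simplex ℝ (EucSpace k) k) : OpenConfig (k + 1) k :=
  ⟨Δ.points, Δ.independent.injective⟩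

/-- `Sim(Δ) ⊆ C_{k+1}(ℝ^k)`. -/
def Sim {k : ℕ} (Δ : Affine.Simplex ℝ (EucSpace k) k) : Set (OpenConfig (k + 1) k) :=
  {q | ∀ t : DistinctTriple (k + 1), distRatio q t = distRatio (simplexConfig Δ) t}

/-- The closure of `Sim(Δ)` in `C_{k+1}[ℝ^k]` (which is closed in `A_{k+1}[ℝ^k]`). -/
def simClosure {k : ℕ} (Δ : Affine.Simplex ℝ (EucSpace k) k) : Set (ConfigAmbient (k + 1) k) :=
  closure (configEmbed '' Sim Δ)

/-- The boundary of the closure of `Sim(Δ)`: what the closure adds to `Sim(Δ)`. -/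
def simBoundary {k : ℕ} (Δ : Affine.Simplex ℝ (EucSpace k) k) : Set (ConfigAmbient (k + 1) k) :=
  simClosure Δ \ configEmbed '' Sim Δ

/-! ### Smooth maps between subsets of Euclidean spaces -/

section Smooth

variable {E F : Type*} [NormedAddCommGroup E] [NormedSpace ℝ E]
  [NormedAddCommGroup F] [NormedSpace ℝ F]

/-- `f` is smooth on the arbitrary subset `X`: near each point of `X` it agrees on `X` with a
`C^∞` map defined on an open subset of the ambient space. -/
def SmoothOnSubset (f : E → F) (X : Set E) : Prop :=
  ∀ x ∈ X, ∃ U : Set E, IsOpen U ∧ x ∈ U ∧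
    ∃ g : E → F, ContDiffOn ℝ ∞ g U ∧ Set.EqOn f g (X ∩ U)

/-- `X` and `Y` are diffeomorphic: there are mutually inverse smooth maps between them. -/
def AreDiffeomorphic (X : Set E) (Y : Set F) : Prop :=
  ∃ (f : E → F) (g : F → E), SmoothOnSubset f X ∧ SmoothOnSubset g Y ∧
    Set.MapsTo f X Y ∧ Set.MapsTo g Y X ∧ Set.InvOn g f X Y

end Smooth

/-- The smooth coordinate `r ↦ r / (1 + r) = 1 - 1 / (1 + r)`, identifying `[0,∞]` with `[0,1]`
(`∞ ↦ 1`). -/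
def ratioCoord (r : ℝ≥0∞) : ℝ := 1 - ((1 + r)⁻¹).toReal

/-- The smooth embedding of `A_n[ℝ^k]` into the vector space
`(ℝ^k)^n × (ℝ^k)^{n(n-1)} × ℝ^{n(n-1)(n-2)}` given by `S^{k-1} ⊆ ℝ^k` and `[0,∞] ≅ [0,1] ⊆ ℝ`.
It defines the smooth structure on subsets of `A_n[ℝ^k]`. -/
def ambientCoord {n k : ℕ} (x : ConfigAmbient n k) :
    (Fin n → EucSpace k) × (DistinctPair n → EucSpace k) × (DistinctTriple n → ℝ) :=
  (x.1, fun p => (x.2.1 p : EucSpace k), fun t => ratioCoord (x.2.2 t))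

/-- `O(k) × {0} × ℝ^k`, as a subset of the vector space `ℝ^{k×k} × ℝ × ℝ^k`. -/
def orthogonalZeroTranslation (k : ℕ) : Set (Matrix (Fin k) (Fin k) ℝ × ℝ × EucSpace k) :=
  (Matrix.orthogonalGroup (Fin k) ℝ : Set (Matrix (Fin k) (Fin k) ℝ)) ×ˢ
    (({0} : Set ℝ) ×ˢ (Set.univ : Set (EucSpace k)))

end

/-! ### Orthogonal matrices recovered from Gram data -/

section OrthogonalMatrices

variable {k : ℕ} {ι : Type*} [Fintype ι]

/-! A simplex similar to `Δ` has all its distances scaled by one factor, so its directions have the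
same Gram matrix as those of `Δ`. Ratios, Gram matrix and proportionality of distances are closed
conditions and survive in the closure. If two points of a limit stay apart, the limit is itself a
nondegenerate simplex similar to `Δ`; hence on the boundary all points collide
(`eq_of_mem_simBoundary`). The ratios there are still those of `Δ`, so nonzero, whereas a smaller
collision forces some ratio to vanish; this rules out every other face.

The directions of `Δ` span, so equality of Gram matrices gives an orthogonal `A` carrying them to
the limiting directions. A boundary point thus amounts to `A` and the collision point `b`, and each
pair occurs as the limit of `b + s A Δ` as `s → 0`. The entries of `A` are linear in the directions
and conversely, so both maps are smooth on the whole ambient space. -/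

theorem norm_toEuclideanLin_of_mem_orthogonalGroup {A : Matrix (Fin k) (Fin k) ℝ}
    (hA : A ∈ Matrix.orthogonalGroup (Fin k) ℝ) (x : EucSpace k) :
    ‖Matrix.toEuclideanLin A x‖ = ‖x‖ := by
  have h : inner ℝ (Matrix.toEuclideanLin A x) (Matrix.toEuclideanLin A x) = inner ℝ x x := by
    rw [EuclideanSpace.inner_eq_star_dotProduct, EuclideanSpace.inner_eq_star_dotProduct,
      Matrix.toLpLin_apply]
    simp only [star_trivial]
    rw [Matrix.dotProduct_mulVec, ← Matrix.mulVec_transpose, Matrix.mulVec_mulVec,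
      (Matrix.mem_orthogonalGroup_iff' (Fin k) ℝ).1 hA, Matrix.one_mulVec]
  rw [real_inner_self_eq_norm_sq, real_inner_self_eq_norm_sq] at h
  exact (sq_eq_sq₀ (norm_nonneg _) (norm_nonneg _)).1 h

/-- The matrix whose `b`-th column is `∑ p, c b p • w p`. -/
def combinationMatrix (c : Fin k → ι → ℝ) (w : ι → EucSpace k) : Matrix (Fin k) (Fin k) ℝ :=
  Matrix.of fun a b => (∑ p, c b p • w p) a

theorem toEuclideanLin_combinationMatrix (c : Fin k → ι → ℝ) (w : ι → EucSpace k)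
    (x : EucSpace k) :
    Matrix.toEuclideanLin (combinationMatrix c w) x = ∑ b, x b • ∑ p, c b p • w p := by
  ext a
  simp [Matrix.toLpLin_apply, Matrix.mulVec, dotProduct, combinationMatrix, mul_comm]

/-- This left inverse, linear in the images of the `v p`, becomes the smooth chart on the boundary.
-/
theorem combinationMatrix_image {c : Fin k → ι → ℝ} {v : ι → EucSpace k}
    (hc : ∀ b, ∑ p, c b p • v p = EuclideanSpace.single b 1) (A : Matrix (Fin k) (Fin k) ℝ) :
    combinationMatrix c (fun p => Matrix.toEuclideanLin A (v p)) = A := by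
  ext a b
  have h : ∑ p, c b p • Matrix.toEuclideanLin A (v p)
      = Matrix.toEuclideanLin A (EuclideanSpace.single b 1) := by
    rw [← hc b, map_sum]
    simp
  simp only [combinationMatrix, Matrix.of_apply, h]
  simp [Matrix.toLpLin_apply]

/-- Inner products of columns involve only the Gram matrix of `w`; replacing it by that of `v` turns
the columns into the standard basis. -/
theorem combinationMatrix_mem_orthogonalGroup {c : Fin k → ι → ℝ} {v w : ι → EucSpace k}
    (hc : ∀ b, ∑ p, c b p • v p = EuclideanSpace.single b 1)
    (hvw : ∀ p p', inner ℝ (w p) (w p') = inner ℝ (v p) (v p')) :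
    combinationMatrix c w ∈ Matrix.orthogonalGroup (Fin k) ℝ := by
  rw [Matrix.mem_orthogonalGroup_iff']
  ext b b'
  have h1 : ((combinationMatrix c w).transpose * combinationMatrix c w) b b'
      = inner ℝ (∑ p, c b p • w p) (∑ p, c b' p • w p) := by
    rw [PiLp.inner_apply, Matrix.mul_apply]
    refine Finset.sum_congr rfl fun a _ => ?_
    simp [combinationMatrix, mul_comm]
  have h2 : inner ℝ (∑ p, c b p • w p) (∑ p, c b' p • w p)
      = inner ℝ (∑ p, c b p • v p) (∑ p, c b' p • v p) := by
    simp only [sum_inner, inner_sum, inner_smul_left, inner_smul_right, hvw]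
  rw [h1, h2, hc, hc]
  rw [EuclideanSpace.inner_single_left]
  simp [Matrix.one_apply]

/-- The `v p` may be linearly dependent, so linearity alone does not suffice. Instead the squared
norm of the difference is expanded: both squared norms and the inner product equal `‖v p‖ ^ 2`. -/
theorem toEuclideanLin_combinationMatrix_eq {c : Fin k → ι → ℝ} {v w : ι → EucSpace k}
    (hc : ∀ b, ∑ p, c b p • v p = EuclideanSpace.single b 1)
    (hvw : ∀ p p', inner ℝ (w p) (w p') = inner ℝ (v p) (v p')) (p : ι) :
    Matrix.toEuclideanLin (combinationMatrix c w) (v p) = w p := by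
  have hv : ∑ b, v p b • ∑ p', c b p' • v p' = v p := by
    ext a
    simp [hc, Pi.single_apply]
  have hn : ‖Matrix.toEuclideanLin (combinationMatrix c w) (v p)‖ ^ 2 = ‖v p‖ ^ 2 := by
    rw [norm_toEuclideanLin_of_mem_orthogonalGroup (combinationMatrix_mem_orthogonalGroup hc hvw)]
  have hw : ‖w p‖ ^ 2 = ‖v p‖ ^ 2 := by
    rw [← real_inner_self_eq_norm_sq, hvw, real_inner_self_eq_norm_sq]
  have hi : inner ℝ (Matrix.toEuclideanLin (combinationMatrix c w) (v p)) (w p) = ‖v p‖ ^ 2 := by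
    rw [toEuclideanLin_combinationMatrix, ← real_inner_self_eq_norm_sq]
    nth_rewrite 2 [← hv]
    simp only [sum_inner, inner_smul_left, hvw]
  rw [← sub_eq_zero, ← norm_eq_zero, ← sq_eq_zero_iff, norm_sub_sq_real, hn, hw, hi]
  ring

end OrthogonalMatrices

/-! ### Directions and ratios of a configuration -/

section Directions

variable {n k : ℕ}

theorem norm_sub_pos_of_ne (q : OpenConfig n k) {i j : Fin n} (h : i ≠ j) :
    0 < ‖q.1 i - q.1 j‖ :=
  norm_pos_iff.2 (sub_ne_zero.2 fun e => h (q.2 e))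

theorem norm_smul_direction (q : OpenConfig n k) (p : DistinctPair n) :
    ‖q.1 p.1.1 - q.1 p.1.2‖ • (direction q p : EucSpace k) = q.1 p.1.1 - q.1 p.1.2 := by
  simp only [direction]
  rw [smul_inv_smul₀ (norm_sub_pos_of_ne q p.2).ne']

theorem distRatio_ne_zero (q : OpenConfig n k) (t : DistinctTriple n) : distRatio q t ≠ 0 := by
  rw [distRatio, Ne, ENNReal.ofReal_eq_zero, not_le]
  exact div_pos (norm_sub_pos_of_ne q t.2.1) (norm_sub_pos_of_ne q t.2.2.2)

theorem inner_sub_sub_eq_dist (a b c d : EucSpace k) :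
    inner ℝ (a - b) (c - d)
      = (‖a - d‖ ^ 2 + ‖b - c‖ ^ 2 - ‖a - c‖ ^ 2 - ‖b - d‖ ^ 2) / 2 := by
  simp only [norm_sub_sq_real, inner_sub_left, inner_sub_right]
  ring

/-- Configurations with proportional mutual distances have the same angles. -/
theorem inner_direction_eq {q q' : OpenConfig n k} {s : ℝ} (hs : 0 < s)
    (h : ∀ i j, ‖q.1 i - q.1 j‖ = s * ‖q'.1 i - q'.1 j‖) (p p' : DistinctPair n) :
    inner ℝ (direction q p : EucSpace k) (direction q p' : EucSpace k)
      = inner ℝ (direction q' p : EucSpace k) (direction q' p' : EucSpace k) := by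
  have h1 := (norm_sub_pos_of_ne q' p.2).ne'
  have h2 := (norm_sub_pos_of_ne q' p'.2).ne'
  simp only [direction, inner_smul_left, inner_smul_right, inner_sub_sub_eq_dist, h]
  simp only [map_inv₀, conj_trivial]
  field_simp

theorem distRatio_eq_of_dist_eq {q q' : OpenConfig n k} {s : ℝ} (hs : 0 < s)
    (h : ∀ i j, ‖q.1 i - q.1 j‖ = s * ‖q'.1 i - q'.1 j‖) : distRatio q = distRatio q' := by
  ext t
  rw [distRatio, distRatio, h, h, mul_div_mul_left _ _ hs.ne']

/-- In the limit, a ratio of distances vanishes as soon as its numerator does and its denominator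
does not. -/
theorem ratio_eq_zero_of_mem_compactConfig {x : ConfigAmbient n k} (hx : x ∈ compactConfig n k)
    (t : DistinctTriple n) (h : x.1 t.1.1 = x.1 t.1.2.1) (h' : x.1 t.1.1 ≠ x.1 t.1.2.2) :
    x.2.2 t = 0 := by
  obtain ⟨u, hu, hlim⟩ := mem_closure_iff_seq_limit.1 hx
  choose q hq using hu
  have h1 : Filter.Tendsto (fun m => (u m).2.2 t) Filter.atTop (nhds (x.2.2 t)) :=
    ((by fun_prop : Continuous fun y : ConfigAmbient n k => y.2.2 t).tendsto x).comp hlim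
  have hd : ∀ i j, Filter.Tendsto (fun m => ‖(u m).1 i - (u m).1 j‖) Filter.atTop
      (nhds ‖x.1 i - x.1 j‖) := fun i j =>
    ((by fun_prop : Continuous fun y : ConfigAmbient n k => ‖y.1 i - y.1 j‖).tendsto x).comp hlim
  have h2 := ENNReal.tendsto_ofReal ((hd t.1.1 t.1.2.1).div (hd t.1.1 t.1.2.2)
    (norm_ne_zero_iff.2 (sub_ne_zero.2 h')))
  rw [h, sub_self, norm_zero, zero_div, ENNReal.ofReal_zero] at h2
  refine tendsto_nhds_unique h1 (h2.congr fun m => ?_)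
  simp only [Pi.div_apply, ← hq m]
  rfl

end Directions

/-! ### Limits of similar simplices -/

section Similarity

variable {k : ℕ} (Δ : Affine.Simplex ℝ (EucSpace k) k)

theorem exists_coeff_direction :
    ∃ c : Fin k → DistinctPair (k + 1) → ℝ, ∀ b,
      ∑ p, c b p • (direction (simplexConfig Δ) p : EucSpace k) = EuclideanSpace.single b 1 := by
  have hspan : Submodule.span ℝ
      (Set.range fun p => (direction (simplexConfig Δ) p : EucSpace k)) = ⊤ := by
    have h := Δ.independent.vectorSpan_eq_top_of_card_eq_finrank_add_one (by simp)
    rw [vectorSpan_range_eq_span_range_vsub_right_ne ℝ _ (0 : Fin (k + 1))] at h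
    rw [eq_top_iff, ← h, Submodule.span_le]
    rintro _ ⟨i, rfl⟩
    have e := norm_smul_direction (simplexConfig Δ) ⟨(i.1, 0), i.2⟩
    change Δ.points i - Δ.points 0 ∈ _
    change _ = Δ.points i - Δ.points 0 at e
    rw [← e]
    exact Submodule.smul_mem _ _ (Submodule.subset_span ⟨_, rfl⟩)
  have h : ∀ b : Fin k, ∃ c : DistinctPair (k + 1) → ℝ,
      ∑ p, c p • (direction (simplexConfig Δ) p : EucSpace k) = EuclideanSpace.single b 1 :=
    fun b => (Submodule.mem_span_range_iff_exists_fun ℝ).1 (hspan ▸ Submodule.mem_top)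
  exact ⟨fun b => (h b).choose, fun b => (h b).choose_spec⟩

variable {Δ}

theorem norm_sub_pos_of_ne_points {i j : Fin (k + 1)} (h : i ≠ j) :
    0 < ‖Δ.points i - Δ.points j‖ :=
  norm_sub_pos_of_ne (simplexConfig Δ) h

theorem dist_eq_of_mem_Sim (hk : 1 ≤ k) {q : OpenConfig (k + 1) k} (hq : q ∈ Sim Δ) :
    ∃ s : ℝ, 0 < s ∧ ∀ i j, ‖q.1 i - q.1 j‖ = s * ‖Δ.points i - Δ.points j‖ := by
  have : NeZero k := ⟨by omega⟩
  have h01 : (0 : Fin (k + 1)) ≠ 1 := by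
    rw [Ne, Fin.zero_eq_one_iff]
    omega
  let s := ‖q.1 0 - q.1 1‖ / ‖Δ.points 0 - Δ.points 1‖
  -- Ratios compare only edges with a common first vertex, so the scale passes from edge to edge
  -- around a vertex, starting from the edge 01.
  have step : ∀ i j l, i ≠ j → ‖q.1 i - q.1 j‖ = s * ‖Δ.points i - Δ.points j‖ →
      ‖q.1 i - q.1 l‖ = s * ‖Δ.points i - Δ.points l‖ := by
    intro i j l hij h
    rcases eq_or_ne i l with rfl | hil
    · simp
    rcases eq_or_ne j l with rfl | hjl
    · exact h
    have hr := hq ⟨(i, l, j), hil, hjl.symm, hij⟩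
    rw [distRatio, distRatio, ENNReal.ofReal_eq_ofReal_iff (by positivity) (by positivity)] at hr
    change ‖q.1 i - q.1 l‖ / ‖q.1 i - q.1 j‖
      = ‖Δ.points i - Δ.points l‖ / ‖Δ.points i - Δ.points j‖ at hr
    have h1 := (norm_sub_pos_of_ne q hij).ne'
    have h2 := (norm_sub_pos_of_ne_points (Δ := Δ) hij).ne'
    rw [div_eq_div_iff h1 h2, h] at hr
    apply mul_right_cancel₀ h2
    rw [hr]
    ring
  have h0 : ∀ l, ‖q.1 0 - q.1 l‖ = s * ‖Δ.points 0 - Δ.points l‖ := fun l =>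
    step 0 1 l h01 (div_mul_cancel₀ _ (norm_sub_pos_of_ne_points h01).ne').symm
  refine ⟨s, div_pos (norm_sub_pos_of_ne q h01) (norm_sub_pos_of_ne_points h01), fun i j => ?_⟩
  rcases eq_or_ne i 0 with rfl | hi
  · exact h0 j
  · refine step i 0 j hi ?_
    rw [norm_sub_rev, h0, norm_sub_rev]

theorem mem_Sim_of_dist_eq {q : OpenConfig (k + 1) k} {s : ℝ} (hs : 0 < s)
    (h : ∀ i j, ‖q.1 i - q.1 j‖ = s * ‖Δ.points i - Δ.points j‖) : q ∈ Sim Δ :=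
  fun t => congrFun (distRatio_eq_of_dist_eq (q' := simplexConfig Δ) hs h) t

theorem ratio_eq_of_mem_simClosure {x : ConfigAmbient (k + 1) k} (hx : x ∈ simClosure Δ) :
    x.2.2 = distRatio (simplexConfig Δ) := by
  refine closure_minimal (t := {y : ConfigAmbient (k + 1) k |
    y.2.2 = distRatio (simplexConfig Δ)}) ?_ (isClosed_eq (by fun_prop) (by fun_prop)) hx
  rintro _ ⟨q, hq, rfl⟩
  exact funext hq

theorem inner_direction_eq_of_mem_simClosure (hk : 1 ≤ k) {x : ConfigAmbient (k + 1) k}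
    (hx : x ∈ simClosure Δ) (p p' : DistinctPair (k + 1)) :
    inner ℝ (x.2.1 p : EucSpace k) (x.2.1 p' : EucSpace k)
      = inner ℝ (direction (simplexConfig Δ) p : EucSpace k)
          (direction (simplexConfig Δ) p' : EucSpace k) := by
  refine closure_minimal (t := {y : ConfigAmbient (k + 1) k |
    inner ℝ (y.2.1 p : EucSpace k) (y.2.1 p' : EucSpace k)
      = inner ℝ (direction (simplexConfig Δ) p : EucSpace k)
          (direction (simplexConfig Δ) p' : EucSpace k)}) ?_
    (isClosed_eq (by fun_prop) (by fun_prop)) hx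
  rintro _ ⟨q, hq, rfl⟩
  obtain ⟨s, hs, h⟩ := dist_eq_of_mem_Sim hk hq
  exact inner_direction_eq (q' := simplexConfig Δ) hs h p p'

/-- Without division, the relation is closed and remains meaningful when points collide. -/
theorem norm_smul_direction_of_mem_compactConfig {n : ℕ} {x : ConfigAmbient n k}
    (hx : x ∈ compactConfig n k) (p : DistinctPair n) :
    ‖x.1 p.1.1 - x.1 p.1.2‖ • (x.2.1 p : EucSpace k) = x.1 p.1.1 - x.1 p.1.2 := by
  refine closure_minimal (t := {y : ConfigAmbient n k |
    ‖y.1 p.1.1 - y.1 p.1.2‖ • (y.2.1 p : EucSpace k) = y.1 p.1.1 - y.1 p.1.2}) ?_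
    (isClosed_eq (by fun_prop) (by fun_prop)) hx
  rintro _ ⟨q, rfl⟩
  exact norm_smul_direction q p

theorem dist_mul_eq_of_mem_simClosure (hk : 1 ≤ k) {x : ConfigAmbient (k + 1) k}
    (hx : x ∈ simClosure Δ) (i j l m : Fin (k + 1)) :
    ‖x.1 i - x.1 j‖ * ‖Δ.points l - Δ.points m‖
      = ‖x.1 l - x.1 m‖ * ‖Δ.points i - Δ.points j‖ := by
  refine closure_minimal (t := {y : ConfigAmbient (k + 1) k |
    ‖y.1 i - y.1 j‖ * ‖Δ.points l - Δ.points m‖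
      = ‖y.1 l - y.1 m‖ * ‖Δ.points i - Δ.points j‖}) ?_
    (isClosed_eq (by fun_prop) (by fun_prop)) hx
  rintro _ ⟨q, hq, rfl⟩
  obtain ⟨s, -, h⟩ := dist_eq_of_mem_Sim hk hq
  simp only [Set.mem_ofPred_eq, configEmbed, h]
  ring

theorem simClosure_subset_compactConfig : simClosure Δ ⊆ compactConfig (k + 1) k :=
  closure_mono (Set.image_subset_range _ _)

/-- All points of a limit of simplices similar to `Δ` coincide, unless the limit is itself similar
to `Δ`. -/
theorem eq_of_mem_simBoundary (hk : 1 ≤ k) {x : ConfigAmbient (k + 1) k}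
    (hx : x ∈ simBoundary Δ) (i j : Fin (k + 1)) : x.1 i = x.1 j := by
  by_contra hij
  have hne : i ≠ j := fun e => hij (by rw [e])
  have hΔ := norm_sub_pos_of_ne_points (Δ := Δ) hne
  have hs : 0 < ‖x.1 i - x.1 j‖ / ‖Δ.points i - Δ.points j‖ :=
    div_pos (norm_pos_iff.2 (sub_ne_zero.2 hij)) hΔ
  have hd : ∀ l m, ‖x.1 l - x.1 m‖
      = ‖x.1 i - x.1 j‖ / ‖Δ.points i - Δ.points j‖ * ‖Δ.points l - Δ.points m‖ := by
    intro l m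
    rw [div_mul_eq_mul_div, eq_div_iff hΔ.ne', dist_mul_eq_of_mem_simClosure hk hx.1]
  have hinj : Function.Injective x.1 := by
    intro l m hlm
    by_contra hne'
    have h := hd l m
    rw [hlm, sub_self, norm_zero] at h
    exact (mul_pos hs (norm_sub_pos_of_ne_points hne')).ne h
  have hq : (⟨x.1, hinj⟩ : OpenConfig (k + 1) k) ∈ Sim Δ := mem_Sim_of_dist_eq hs hd
  refine hx.2 ⟨⟨x.1, hinj⟩, hq, ?_⟩
  refine Prod.ext rfl (Prod.ext (funext fun p => Subtype.ext ?_) ?_)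
  · have h1 := norm_smul_direction_of_mem_compactConfig (simClosure_subset_compactConfig hx.1) p
    have h2 : ‖x.1 p.1.1 - x.1 p.1.2‖ ≠ 0 :=
      (norm_sub_pos_of_ne (⟨x.1, hinj⟩ : OpenConfig (k + 1) k) p.2).ne'
    change ‖x.1 p.1.1 - x.1 p.1.2‖⁻¹ • (x.1 p.1.1 - x.1 p.1.2) = (x.2.1 p : EucSpace k)
    rw [inv_smul_eq_iff₀ h2, h1]
  · rw [ratio_eq_of_mem_simClosure hx.1]
    exact funext hq

theorem not_mem_range_configEmbed (hk : 1 ≤ k) {x : ConfigAmbient (k + 1) k}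
    (hx : ∀ i j, x.1 i = x.1 j) : x ∉ Set.range (configEmbed (n := k + 1) (k := k)) := by
  rintro ⟨q, rfl⟩
  have h : (0 : Fin (k + 1)) = Fin.last k := q.2 (hx _ _)
  rw [Fin.ext_iff] at h
  simp at h
  omega

/-- The boundary of `Sim Δ` lies in the interior of the face where all points collide. -/
theorem simBoundary_subset_collisionFaceInterior (hk : 1 ≤ k) :
    simBoundary Δ ⊆ collisionFaceInterior k (Finset.univ : Finset (Fin (k + 1))) := by
  intro x hx
  have heq := eq_of_mem_simBoundary hk hx
  have hr := ratio_eq_of_mem_simClosure hx.1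
  refine ⟨subset_closure ⟨⟨simClosure_subset_compactConfig hx.1,
    not_mem_range_configEmbed hk heq⟩, fun i j => ?_, fun t _ _ _ => ?_⟩, fun T hT hTne hxT => ?_⟩
  · simp [heq i j]
  · rw [hr]
    exact ⟨distRatio_ne_zero _ _, ENNReal.ofReal_ne_top⟩
  · obtain ⟨i, hi, j, hj, hij⟩ := Finset.one_lt_card.1 hT
    obtain ⟨l, hl⟩ : ∃ l, l ∉ T := by
      by_contra! h
      exact hTne (Finset.eq_univ_iff_forall.2 h)
    have hil : i ≠ l := fun e => hl (e ▸ hi)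
    have hjl : j ≠ l := fun e => hl (e ▸ hj)
    -- On the open stratum of `T`, `i` and `j` collide away from `l`, so this ratio is zero there,
    -- and hence on the closed face.
    have h0 : x.2.2 ⟨(i, j, l), hij, hjl, hil⟩ = 0 := by
      refine closure_minimal (t := {y : ConfigAmbient (k + 1) k |
        y.2.2 ⟨(i, j, l), hij, hjl, hil⟩ = 0}) ?_ (isClosed_eq (by fun_prop) (by fun_prop)) hxT
      intro y hy
      refine ratio_eq_zero_of_mem_compactConfig hy.1.1 _ ((hy.2.1 i j).2 (Or.inr ⟨hi, hj⟩)) ?_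
      intro e
      rcases (hy.2.1 i l).1 e with e | e
      · exact hil e
      · exact hl e.2
    rw [hr] at h0
    exact distRatio_ne_zero _ _ h0

/-- The limit of the simplices `b + s A Δ` as `s` tends to `0` belongs to the boundary. -/
theorem mem_simBoundary_of_orthogonal (hk : 1 ≤ k) {A : Matrix (Fin k) (Fin k) ℝ}
    (hA : A ∈ Matrix.orthogonalGroup (Fin k) ℝ) (b : EucSpace k) {x : ConfigAmbient (k + 1) k}
    (h1 : ∀ i, x.1 i = b)
    (h2 : ∀ p, (x.2.1 p : EucSpace k)
      = Matrix.toEuclideanLin A (direction (simplexConfig Δ) p : EucSpace k))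
    (h3 : x.2.2 = distRatio (simplexConfig Δ)) : x ∈ simBoundary Δ := by
  refine ⟨?_, fun h => not_mem_range_configEmbed hk (fun i j => by rw [h1, h1])
    (Set.image_subset_range _ _ h)⟩
  -- Dilation changes neither directions nor ratios, so only the points depend on `s`, and the path
  -- extends continuously to `s = 0`.
  let y : ℝ → ConfigAmbient (k + 1) k :=
    fun s => (fun i => b + s • Matrix.toEuclideanLin A (Δ.points i), x.2.1, x.2.2)
  have hy : Continuous y := by fun_prop
  have hy0 : y 0 = x := Prod.ext (funext fun i => by simp [y, h1]) rfl
  have hmem : ∀ s ∈ Set.Ioi (0 : ℝ), y s ∈ configEmbed '' Sim Δ := by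
    intro s hs
    have hs : 0 < s := hs
    have hsub : ∀ i j, (y s).1 i - (y s).1 j
        = s • Matrix.toEuclideanLin A (Δ.points i - Δ.points j) := by
      intro i j
      simp [y, smul_sub]
    have hd : ∀ i j, ‖(y s).1 i - (y s).1 j‖ = s * ‖Δ.points i - Δ.points j‖ := by
      intro i j
      rw [hsub, norm_smul, norm_toEuclideanLin_of_mem_orthogonalGroup hA, Real.norm_of_nonneg hs.le]
    have hinj : Function.Injective (y s).1 := by
      intro i j hij
      by_contra hne
      have h := hd i j
      rw [hij, sub_self, norm_zero] at h
      exact (mul_pos hs (norm_sub_pos_of_ne_points hne)).ne h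
    have hq : (⟨(y s).1, hinj⟩ : OpenConfig (k + 1) k) ∈ Sim Δ := mem_Sim_of_dist_eq hs hd
    refine ⟨⟨(y s).1, hinj⟩, hq, Prod.ext rfl (Prod.ext (funext fun p => Subtype.ext ?_) ?_)⟩
    · change ‖(y s).1 p.1.1 - (y s).1 p.1.2‖⁻¹ • ((y s).1 p.1.1 - (y s).1 p.1.2)
        = (x.2.1 p : EucSpace k)
      rw [hd, hsub, h2]
      change _ = Matrix.toEuclideanLin A
        (‖Δ.points p.1.1 - Δ.points p.1.2‖⁻¹ • (Δ.points p.1.1 - Δ.points p.1.2))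
      rw [map_smul, smul_smul, mul_inv, mul_right_comm, inv_mul_cancel₀ hs.ne', one_mul]
    · change _ = x.2.2
      rw [h3]
      exact funext hq
  have hcl : (0 : ℝ) ∈ closure (Set.Ioi (0 : ℝ)) := by simp
  rw [← hy0]
  exact map_mem_closure hy hcl hmem

theorem exists_orthogonal_of_mem_simBoundary (hk : 1 ≤ k) {x : ConfigAmbient (k + 1) k}
    (hx : x ∈ simBoundary Δ) :
    ∃ A ∈ Matrix.orthogonalGroup (Fin k) ℝ, ∀ p, (x.2.1 p : EucSpace k)
      = Matrix.toEuclideanLin A (direction (simplexConfig Δ) p : EucSpace k) := by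
  obtain ⟨c, hc⟩ := exists_coeff_direction Δ
  have h := inner_direction_eq_of_mem_simClosure hk hx.1
  exact ⟨combinationMatrix c fun p => (x.2.1 p : EucSpace k),
    combinationMatrix_mem_orthogonalGroup hc h,
    fun p => (toEuclideanLin_combinationMatrix_eq (w := fun p => (x.2.1 p : EucSpace k))
      hc h p).symm⟩

end Similarity

/-! ### Smooth parametrization of the boundary -/

section Parametrization

variable {k : ℕ} (Δ : Affine.Simplex ℝ (EucSpace k) k)

/-- The parametrization of `∂ Sim Δ` by `O(k) × {0} × ℝ^k`, in ambient coordinates. -/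
noncomputable def simBoundaryParam (z : Matrix (Fin k) (Fin k) ℝ × ℝ × EucSpace k) :
    (Fin (k + 1) → EucSpace k) × (DistinctPair (k + 1) → EucSpace k) ×
      (DistinctTriple (k + 1) → ℝ) :=
  (fun _ => z.2.2,
    fun p => Matrix.toEuclideanLin z.1 (direction (simplexConfig Δ) p : EucSpace k),
    fun t => ratioCoord (distRatio (simplexConfig Δ) t))

theorem contDiff_simBoundaryParam : ContDiff ℝ ∞ (simBoundaryParam Δ) := by
  refine (contDiff_pi.2 fun _ => contDiff_snd.comp contDiff_snd).prodMk
    ((contDiff_pi.2 fun p => ?_).prodMk contDiff_const)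
  refine contDiff_euclidean.2 fun a => ?_
  simp only [Matrix.toLpLin_apply, Matrix.mulVec, dotProduct]
  exact ContDiff.sum fun b _ => ((contDiff_apply_apply ℝ ℝ a b).comp contDiff_fst).mul contDiff_const

theorem contDiff_combinationMatrix {ι : Type*} [Fintype ι] (c : Fin k → ι → ℝ) :
    ContDiff ℝ ∞ (combinationMatrix (k := k) c) := by
  refine contDiff_pi.2 fun a => contDiff_pi.2 fun b => ?_
  simp only [combinationMatrix, Matrix.of_apply]
  fun_prop

theorem image_simBoundary (hk : 1 ≤ k) :
    ambientCoord '' simBoundary Δ = simBoundaryParam Δ '' orthogonalZeroTranslation k := by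
  ext y
  constructor
  · rintro ⟨x, hx, rfl⟩
    obtain ⟨A, hA, h⟩ := exists_orthogonal_of_mem_simBoundary hk hx
    refine ⟨(A, 0, x.1 0), ⟨hA, rfl, trivial⟩, ?_⟩
    refine Prod.ext (funext fun i => eq_of_mem_simBoundary hk hx _ _)
      (Prod.ext (funext fun p => (h p).symm) (funext fun t => ?_))
    simp [simBoundaryParam, ambientCoord, ratio_eq_of_mem_simClosure hx.1]
  · rintro ⟨⟨A, r, b⟩, ⟨hA, -, -⟩, rfl⟩
    refine ⟨(fun _ => b, fun p => ⟨Matrix.toEuclideanLin A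
      (direction (simplexConfig Δ) p : EucSpace k), ?_⟩, distRatio (simplexConfig Δ)),
      mem_simBoundary_of_orthogonal hk hA b (fun _ => rfl) (fun _ => rfl) rfl, rfl⟩
    rw [mem_sphere_zero_iff_norm, norm_toEuclideanLin_of_mem_orthogonalGroup hA]
    exact norm_eq_of_mem_sphere _

theorem areDiffeomorphic_simBoundary (hk : 1 ≤ k) :
    AreDiffeomorphic (ambientCoord '' simBoundary Δ) (orthogonalZeroTranslation k) := by
  obtain ⟨c, hc⟩ := exists_coeff_direction Δ
  rw [image_simBoundary Δ hk]
  -- All points coincide on the boundary, so vertex 0 gives the translation.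
  let f : (Fin (k + 1) → EucSpace k) × (DistinctPair (k + 1) → EucSpace k) ×
      (DistinctTriple (k + 1) → ℝ) → Matrix (Fin k) (Fin k) ℝ × ℝ × EucSpace k :=
    fun y => (combinationMatrix c y.2.1, 0, y.1 0)
  have hf : ContDiff ℝ ∞ f :=
    ((contDiff_combinationMatrix c).comp (contDiff_fst.comp contDiff_snd)).prodMk
      (contDiff_const.prodMk (by fun_prop))
  have hinv : ∀ z ∈ orthogonalZeroTranslation k, f (simBoundaryParam Δ z) = z := by
    rintro ⟨A, r, b⟩ ⟨-, hr, -⟩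
    exact Prod.ext (combinationMatrix_image hc A) (Prod.ext hr.symm rfl)
  refine ⟨f, simBoundaryParam Δ,
    fun x _ => ⟨Set.univ, isOpen_univ, trivial, f, hf.contDiffOn, fun _ _ => rfl⟩,
    fun x _ => ⟨Set.univ, isOpen_univ, trivial, _, (contDiff_simBoundaryParam Δ).contDiffOn,
      fun _ _ => rfl⟩, ?_, Set.mapsTo_image _ _, ?_, hinv⟩
  · rintro _ ⟨z, hz, rfl⟩
    rwa [hinv z hz]
  · rintro _ ⟨z, hz, rfl⟩
    rw [hinv z hz]

end Parametrization

theorem mainTheorem5 (k : ℕ) (hk : 1 ≤ k)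
    (Δ : Affine.Simplex ℝ (EuclideanSpace ℝ (Fin k)) k) :
    simBoundary Δ ⊆ collisionFaceInterior k (Finset.univ : Finset (Fin (k + 1))) ∧
      AreDiffeomorphic (ambientCoord '' simBoundary Δ) (orthogonalZeroTranslation k) :=
  ⟨simBoundary_subset_collisionFaceInterior hk, areDiffeomorphic_simBoundary Δ hk⟩
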